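/- Let $\mathcal H$ be a separable complex Hilbert space. For a bounded operator $A$ on $\mathcal H$ put $|A|=(A^*A)^{1/2}$. For $0<p<\infty$ let $\|A\|_p=(\operatorname{tr}|A|^p)^{1/p}$, and let the Schatten $p$-class $C_p$ be the set of compact operators $A$ on $\mathcal H$ with $\operatorname{tr}|A|^p<\infty$. Let $p>0$ and let $A_1,\dots,A_n\in C_p$ satisfy $\sum_{i=1}^n A_i=0$. Then all the operators $A_i+A_j$ and $A_i-A_j$ belong to $C_p$, and, for either choice of the sign $\pm$ (the same in all terms of the sum), $$2^{p/2}n^{p-1}\sum_{i=1}^n\|A_i\|_p^p\;\le\;\sum_{i,j=1}^n\|A_i\pm A_j\|_p^p\qquad\text{if } 0<p\le 2,$$ $$\sum_{i,j=1}^n\|A_i\pm A_j\|_p^p\;\le\;2^{p/2}n^{p-1}\sum_{i=1}^n\|A_i\|_p^p\qquad\text{if } 2\le p<\infty.$$ In particular, for $p=2$, $$\sum_{i,j=1}^n\|A_i-A_j\|_2^2=2n\sum_{i=1}^n\|A_i\|_2^2 .$$ -/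

import Mathlib

open scoped InnerProductSpace

/-- The canonical trace `∑ ⟨e, T e⟩ ∈ [0, ∞]` of a positive operator `T`, computed in a chosen
orthonormal basis of the Hilbert space; the value does not depend on the basis
(see `posTrace_eq_tsum`). -/
noncomputable def posTrace {H : Type*} [NormedAddCommGroup H] [InnerProductSpace ℂ H]
    [CompleteSpace H] (T : H →L[ℂ] H) : ENNReal :=
  ∑' e, ENNReal.ofReal (⟪(exists_hilbertBasis ℂ H).choose_spec.choose e,
    T ((exists_hilbertBasis ℂ H).choose_spec.choose e)⟫_ℂ).re

/-- `tr |A| ^ p ∈ [0, ∞]`, where `|A| = (A* A) ^ (1 / 2)` and the powers are taken in the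
continuous functional calculus. -/
noncomputable def traceAbsPow {H : Type*} [NormedAddCommGroup H] [InnerProductSpace ℂ H]
    [CompleteSpace H] (p : ℝ) (A : H →L[ℂ] H) : ENNReal :=
  posTrace (CFC.abs A ^ p)

/-- The Schatten `p`-class `C_p`: compact operators `A` with `tr |A| ^ p < ∞`. -/
def SchattenClass {H : Type*} [NormedAddCommGroup H] [InnerProductSpace ℂ H]
    [CompleteSpace H] (p : ℝ) : Set (H →L[ℂ] H) :=
  {A | IsCompactOperator A ∧ traceAbsPow p A < ⊤}

/-- The Schatten `p`-norm (quasi-norm when `p < 1`) `‖A‖_p = (tr |A| ^ p) ^ (1 / p)`,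
as a real number; meaningful for `A` in `SchattenClass p`. -/
noncomputable def schattenNorm {H : Type*} [NormedAddCommGroup H] [InnerProductSpace ℂ H]
    [CompleteSpace H] (p : ℝ) (A : H →L[ℂ] H) : ℝ :=
  (traceAbsPow p A).toReal ^ (1 / p)

theorem ofReal_norm_sq_eq_tsum {H ι : Type*} [NormedAddCommGroup H] [InnerProductSpace ℂ H]
    (b : HilbertBasis ι ℂ H) (x : H) :
    ENNReal.ofReal (‖x‖ ^ 2) = ∑' i, ENNReal.ofReal (‖⟪b i, x⟫_ℂ‖ ^ 2) := by
  have h := b.hasSum_inner_mul_inner x x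
  have h2 : HasSum (fun i => ‖⟪b i, x⟫_ℂ‖ ^ 2) (‖x‖ ^ 2) := by
    have h3 := Complex.hasSum_re h
    rw [inner_self_eq_norm_sq_to_K] at h3
    convert h3 using 1
    · funext i
      rw [← inner_conj_symm x (b i), Complex.conj_mul']
      norm_cast
    · norm_cast
  rw [← h2.tsum_eq, ENNReal.ofReal_tsum_of_nonneg (fun _ => by positivity) h2.summable]

theorem tsum_inner_basis_comm {H ι κ : Type*} [NormedAddCommGroup H] [InnerProductSpace ℂ H]
    [CompleteSpace H] (T : H →L[ℂ] H) (hT : 0 ≤ T)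
    (b : HilbertBasis ι ℂ H) (c : HilbertBasis κ ℂ H) :
    ∑' i, ENNReal.ofReal (⟪b i, T (b i)⟫_ℂ).re = ∑' j, ENNReal.ofReal (⟪c j, T (c j)⟫_ℂ).re := by
  obtain ⟨S, hS, hST⟩ : ∃ S : H →L[ℂ] H, IsSelfAdjoint S ∧ S * S = T :=
    ⟨CFC.sqrt T, (CFC.sqrt_nonneg T).isSelfAdjoint, CFC.sqrt_mul_sqrt_self T hT⟩
  have hsym : ∀ x y, ⟪S x, y⟫_ℂ = ⟪x, S y⟫_ℂ := fun x y =>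
    (ContinuousLinearMap.isSelfAdjoint_iff_isSymmetric.mp hS) x y
  have key : ∀ x, (⟪x, T x⟫_ℂ).re = ‖S x‖ ^ 2 := fun x => by
    rw [← hST, mul_apply_eq_comp, ← hsym, inner_self_eq_norm_sq_to_K]
    norm_cast
  simp only [key]
  simp_rw [ofReal_norm_sq_eq_tsum c (S (b _)), ofReal_norm_sq_eq_tsum b (S (c _))]
  rw [ENNReal.tsum_comm]
  refine tsum_congr fun j => tsum_congr fun i => ?_
  rw [← hsym, norm_inner_symm]

/-- The trace of a positive operator may be computed in any orthonormal basis. -/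
theorem posTrace_eq_tsum {H ι : Type*} [NormedAddCommGroup H] [InnerProductSpace ℂ H]
    [CompleteSpace H] (T : H →L[ℂ] H) (hT : 0 ≤ T) (b : HilbertBasis ι ℂ H) :
    posTrace T = ∑' i, ENNReal.ofReal (⟪b i, T (b i)⟫_ℂ).re :=
  tsum_inner_basis_comm T hT _ b

/-! Write `|X|² = X*X` and `q = p/2`. Because `∑ A_i = 0`, the cross terms cancel and `∑_{i,j} |A_i
± A_j|² = 2n ∑ |A_i|²`. For `q ≥ 1` the trace of a `q`-th power is superadditive on positive compact
operators (`sum_posTrace_rpow_le`), and convexity costs a factor `n^(q-1)`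
(`posTrace_rpow_sum_le_card_mul`). Applying the first to the left side and the second to the right
gives the constant `(2n)^q n^(q-1) = 2^(p/2) n^(p-1)`. For `q ≤ 1` both inequalities reverse.

Superadditivity: with `S = ∑ T_k`, `tr S^q = ∑_k tr(S^(q-1) T_k)`. In an eigenbasis `c_j` of `T_k`
with eigenvalues `t_j`, the `k`-th term is `∑_j t_j ⟨c_j, S^(q-1) c_j⟩`, so it suffices to compare
`⟨c_j, S^(q-1) c_j⟩` with `t_j^(q-1)`. Löwner–Heinz and Jensen's inequality do this
(`rpow_le_quadForm_rpow`, `tsum_rpow_neg_le`). Working in `[0, ∞]` avoids all summability questions.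
-/

/-! ### Diagonalization of compact positive operators. -/

section Eigenbasis

variable {H : Type*} [NormedAddCommGroup H] [InnerProductSpace ℂ H] [CompleteSpace H]

open scoped ComplexOrder in
/-- A compact positive operator is diagonal in some Hilbert basis, with nonnegative eigenvalues. -/
theorem exists_hilbertBasis_eigenvectors.{u} {H : Type u} [NormedAddCommGroup H]
    [InnerProductSpace ℂ H] [CompleteSpace H] {T : H →L[ℂ] H} (hT : 0 ≤ T)
    (hc : IsCompactOperator T) :
    ∃ (ι : Type u) (b : HilbertBasis ι ℂ H) (t : ι → NNReal),
      ∀ i, T (b i) = ((t i : ℝ) : ℂ) • b i := by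
  have hpos : T.IsPositive := (ContinuousLinearMap.nonneg_iff_isPositive T).mp hT
  have hsym : (T : H →ₗ[ℂ] H).IsSymmetric := hpos.isSymmetric
  let E : ℂ → Submodule ℂ H := fun μ => Module.End.eigenspace (T : H →ₗ[ℂ] H) μ
  have hclosed : ∀ μ, IsClosed (E μ : Set H) := fun μ => by
    have : (E μ : Set H) = {x | T x = μ • x} := by
      ext x; exact Module.End.mem_eigenspace_iff
    rw [this]
    exact isClosed_eq T.continuous (continuous_const_smul μ)
  have : ∀ μ, CompleteSpace (E μ) := fun μ => (hclosed μ).completeSpace_coe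
  choose w c _ using fun μ => exists_hilbertBasis ℂ (E μ)
  have hfam : OrthogonalFamily ℂ (fun μ => E μ) fun μ => (E μ).subtypeₗᵢ :=
    hsym.orthogonalFamily_eigenspaces
  let v : (Σ μ, w μ) → H := fun a => (c a.1 a.2 : E a.1)
  have hv : Orthonormal ℂ v :=
    hfam.orthonormal_sigma_orthonormal (v_family := fun μ => c μ) fun μ => (c μ).orthonormal
  have hTv : ∀ a, T (v a) = a.1 • v a := fun a =>
    Module.End.mem_eigenspace_iff.mp (c a.1 a.2).2
  have hbot : (Submodule.span ℂ (Set.range v))ᗮ = ⊥ := by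
    rw [eq_bot_iff, ← ContinuousLinearMap.orthogonalComplement_iSup_eigenspaces_eq_bot hc hsym]
    intro x hx
    rw [← Submodule.iInf_orthogonal, Submodule.mem_iInf]
    intro μ
    rw [Submodule.mem_orthogonal']
    intro y hy
    -- Pairing `x` with the expansion of `y` in the basis of its eigenspace gives a series of zeros.
    have h := ((c μ).hasSum_repr ⟨y, hy⟩).mapL (innerSL ℂ x ∘L (E μ).subtypeL)
    refine h.unique (.congr_fun hasSum_zero fun i => ?_)
    have hi : ⟪x, v ⟨μ, i⟩⟫_ℂ = 0 :=
      (Submodule.mem_orthogonal' _ _).mp hx _ (Submodule.subset_span ⟨_, rfl⟩)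
    simpa [v] using Or.inr hi
  -- In the order on `ℂ`, `0 ≤ a.1` also says that the eigenvalue is real.
  have hre : ∀ a : Σ μ, w μ, 0 ≤ a.1 := fun a => by
    have h := hpos.inner_nonneg_right (v a)
    rwa [hTv, inner_smul_right, inner_self_eq_norm_sq_to_K, hv.1 a, RCLike.ofReal_one, one_pow,
      mul_one] at h
  refine ⟨_, HilbertBasis.mkOfOrthogonalEqBot hv hbot,
    fun a => ⟨a.1.re, (Complex.le_def.mp (hre a)).1⟩, fun a => ?_⟩
  rw [HilbertBasis.coe_mkOfOrthogonalEqBot, hTv]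
  congr 1
  exact Complex.ext rfl (Complex.le_def.mp (hre a)).2.symm

open Polynomial in
/-- The continuous functional calculus acts on eigenvectors through the eigenvalue. -/
theorem cfc_apply_eigenvector {T : H →L[ℂ] H} (hT : IsSelfAdjoint T) {f : ℝ → ℝ}
    (hf : Continuous f) {t : ℝ} {x : H} (hx : T x = (t : ℂ) • x) :
    cfc f T x = (f t : ℂ) • x := by
  -- The point `t` is adjoined because it need not lie in the spectrum when `x = 0`.
  obtain ⟨R, hR⟩ : ∃ R : ℝ, ∀ y ∈ insert t (spectrum ℝ T), |y| ≤ R := by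
    have : Bornology.IsBounded (insert t (spectrum ℝ T)) :=
      Bornology.isBounded_insert.mpr (spectrum.isBounded T)
    simpa using this.exists_norm_le
  have key : ∀ ε : ℝ, 0 < ε → ‖cfc f T x - (f t : ℂ) • x‖ ≤ ε * ‖x‖ + ε * ‖x‖ := fun ε hε => by
    obtain ⟨q, hq⟩ := exists_polynomial_near_of_continuousOn (-R) R f hf.continuousOn ε hε
    have hq' : ∀ y ∈ insert t (spectrum ℝ T), |q.eval y - f y| < ε := fun y hy =>
      hq y (abs_le.mp (hR y hy))
    have h1 : cfc q.eval T x = ((q.eval t : ℝ) : ℂ) • x := by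
      rw [cfc_polynomial q T]
      have : ∀ n : ℕ, (T ^ n) x = ((t : ℂ) ^ n) • x := fun n => by
        induction n with
        | zero => simp
        | succ n ih =>
          rw [pow_succ, mul_apply_eq_comp, hx, map_smul, ih, smul_smul]; congr 1; ring
      rw [aeval_eq_sum_range, eval_eq_sum_range]
      simp only [sum_apply, Complex.ofReal_sum, Finset.sum_smul]
      refine Finset.sum_congr rfl fun n _ => ?_
      rw [smul_apply, this, ← Complex.coe_smul, smul_smul]
      push_cast; rfl
    have h2 : ‖cfc f T - cfc q.eval T‖ ≤ ε := by
      rw [← cfc_sub f q.eval T]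
      refine norm_cfc_le hε.le fun y hy => ?_
      rw [norm_sub_rev]
      exact (hq' y (Set.mem_insert_of_mem _ hy)).le
    calc ‖cfc f T x - (f t : ℂ) • x‖
        = ‖(cfc f T - cfc q.eval T) x + ((q.eval t - f t : ℝ) : ℂ) • x‖ := by
          rw [sub_apply, h1]; push_cast; rw [sub_smul]; congr 1; abel
      _ ≤ ‖(cfc f T - cfc q.eval T) x‖ + ‖((q.eval t - f t : ℝ) : ℂ) • x‖ := norm_add_le _ _
      _ ≤ ε * ‖x‖ + ε * ‖x‖ := by
          gcongr
          · exact ContinuousLinearMap.le_of_opNorm_le _ h2 x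
          · rw [norm_smul, Complex.norm_real]
            gcongr
            exact (hq' t (Set.mem_insert _ _)).le
  rw [← sub_eq_zero, ← norm_le_zero_iff]
  refine le_of_forall_pos_le_add fun δ hδ => ?_
  have := key (δ / (2 * (‖x‖ + 1))) (by positivity)
  refine this.trans ?_
  rw [zero_add, ← two_mul, ← mul_assoc, mul_div, mul_div_mul_left _ _ two_ne_zero, div_mul_eq_mul_div,
    div_le_iff₀ (by positivity)]
  nlinarith [norm_nonneg x]

theorem rpow_apply_eigenvector {T : H →L[ℂ] H} (hT : 0 ≤ T) {q : ℝ} (hq : 0 ≤ q) {t : ℝ}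
    {x : H} (hx : T x = (t : ℂ) • x) : (T ^ q) x = ((t ^ q : ℝ) : ℂ) • x := by
  rw [CFC.rpow_eq_cfc_real]
  exact cfc_apply_eigenvector hT.isSelfAdjoint (Real.continuous_rpow_const hq) hx

end Eigenbasis

/-! ### Quadratic forms of operator powers: Jensen and Löwner–Heinz. -/

section QuadForm

open scoped ENNReal NNReal

variable {H : Type*} [NormedAddCommGroup H] [InnerProductSpace ℂ H] [CompleteSpace H]

/-- The quadratic form `⟨x, T x⟩ ∈ [0, ∞]` of a positive operator. -/
noncomputable def quadForm (T : H →L[ℂ] H) (x : H) : ℝ≥0∞ :=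
  ENNReal.ofReal (⟪x, T x⟫_ℂ).re

omit [CompleteSpace H] in
theorem re_inner_apply_nonneg {T : H →L[ℂ] H} (hT : 0 ≤ T) (x : H) : 0 ≤ (⟪x, T x⟫_ℂ).re :=
  ((ContinuousLinearMap.nonneg_iff_isPositive T).mp hT).re_inner_nonneg_right x

theorem quadForm_mono {S T : H →L[ℂ] H} (h : T ≤ S) (x : H) : quadForm T x ≤ quadForm S x := by
  refine ENNReal.ofReal_le_ofReal ?_
  have := re_inner_apply_nonneg (sub_nonneg.mpr h) x
  rw [sub_apply, inner_sub_right, Complex.sub_re] at this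
  linarith

omit [CompleteSpace H] in
theorem quadForm_sum {κ : Type*} (s : Finset κ) {T : κ → H →L[ℂ] H} (hT : ∀ k ∈ s, 0 ≤ T k)
    (x : H) : quadForm (∑ k ∈ s, T k) x = ∑ k ∈ s, quadForm (T k) x := by
  unfold quadForm
  rw [sum_apply, inner_sum, Complex.re_sum,
    ENNReal.ofReal_sum_of_nonneg fun k hk => re_inner_apply_nonneg (hT k hk) x]

omit [CompleteSpace H] in
theorem quadForm_eigenvector {T : H →L[ℂ] H} {t : ℝ≥0} {x : H} (hx : T x = ((t : ℝ) : ℂ) • x)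
    (h1 : ‖x‖ = 1) : quadForm T x = t := by
  rw [quadForm, hx, inner_smul_right, inner_self_eq_norm_sq_to_K, h1]
  simp

theorem rpow_apply_eigenvector_nnreal {T : H →L[ℂ] H} (hT : 0 ≤ T) {q : ℝ} (hq : 0 ≤ q) {t : ℝ≥0}
    {x : H} (hx : T x = ((t : ℝ) : ℂ) • x) : (T ^ q) x = (((t ^ q : ℝ≥0) : ℝ) : ℂ) • x := by
  rw [rpow_apply_eigenvector hT hq hx, NNReal.coe_rpow]

theorem posTrace_eq_tsum_quadForm {ι : Type*} {T : H →L[ℂ] H} (hT : 0 ≤ T)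
    (b : HilbertBasis ι ℂ H) : posTrace T = ∑' i, quadForm T (b i) :=
  posTrace_eq_tsum T hT b

omit [CompleteSpace H] in
theorem quadForm_eq_tsum {ι : Type*} {T : H →L[ℂ] H} (hT : 0 ≤ T) {b : HilbertBasis ι ℂ H}
    {t : ι → ℝ≥0} (hb : ∀ i, T (b i) = ((t i : ℝ) : ℂ) • b i) (x : H) :
    quadForm T x = ∑' i, (t i : ℝ≥0∞) * ENNReal.ofReal (‖⟪b i, x⟫_ℂ‖ ^ 2) := by
  have hsym := ((ContinuousLinearMap.nonneg_iff_isPositive T).mp hT).inner_left_eq_inner_right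
  have h : HasSum (fun i => (t i : ℝ) * ‖⟪b i, x⟫_ℂ‖ ^ 2) (⟪x, T x⟫_ℂ).re := by
    convert Complex.hasSum_re (b.hasSum_inner_mul_inner x (T x)) using 2 with i
    rw [← hsym, hb, inner_smul_left, Complex.conj_ofReal, ← inner_conj_symm x (b i),
      mul_left_comm, Complex.conj_mul']
    norm_cast
  rw [quadForm, ← h.tsum_eq, ENNReal.ofReal_tsum_of_nonneg (fun _ => by positivity) h.summable]
  refine tsum_congr fun i => ?_
  rw [ENNReal.ofReal_mul (NNReal.coe_nonneg _), ENNReal.ofReal_coe_nnreal]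

theorem posTrace_rpow_eq_tsum {ι : Type*} {T : H →L[ℂ] H} (hT : 0 ≤ T) {b : HilbertBasis ι ℂ H}
    {t : ι → ℝ≥0} (hb : ∀ i, T (b i) = ((t i : ℝ) : ℂ) • b i) {q : ℝ} (hq : 0 ≤ q) :
    posTrace (T ^ q) = ∑' i, ((t i ^ q : ℝ≥0) : ℝ≥0∞) := by
  rw [posTrace_eq_tsum_quadForm CFC.rpow_nonneg b]
  exact tsum_congr fun i =>
    quadForm_eigenvector (rpow_apply_eigenvector_nnreal hT hq (hb i)) (b.orthonormal.1 i)

/-- Jensen for probability weights: Hölder on each finite partial sum, whose total weight is at most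
one. -/
theorem ENNReal.tsum_mul_rpow_le {ι : Type*} {w f : ι → ℝ≥0∞} (hw : ∑' i, w i = 1) {q : ℝ}
    (hq : 1 ≤ q) : (∑' i, w i * f i) ^ q ≤ ∑' i, w i * f i ^ q := by
  have hq0 : 0 < q := by linarith
  rw [← ENNReal.le_rpow_inv_iff hq0, ENNReal.tsum_eq_iSup_sum]
  refine iSup_le fun s => (ENNReal.inner_le_weight_mul_Lp_of_nonneg s hq w f).trans ?_
  calc _ ≤ (1 : ℝ≥0∞) ^ (1 - q⁻¹) * (∑' i, w i * f i ^ q) ^ q⁻¹ := by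
        gcongr
        · exact sub_nonneg.mpr (inv_le_one_of_one_le₀ hq)
        · exact hw ▸ ENNReal.sum_le_tsum s
        · exact ENNReal.sum_le_tsum s
    _ = _ := by rw [ENNReal.one_rpow, one_mul]

/-- Jensen's inequality for the vector state of a unit vector and a convex power. -/
theorem quadForm_rpow_le {T : H →L[ℂ] H} (hT : 0 ≤ T) (hc : IsCompactOperator T) {q : ℝ}
    (hq : 1 ≤ q) {x : H} (hx : ‖x‖ = 1) : quadForm T x ^ q ≤ quadForm (T ^ q) x := by
  obtain ⟨ι, b, t, hb⟩ := exists_hilbertBasis_eigenvectors hT hc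
  have hq0 : 0 ≤ q := by linarith
  rw [quadForm_eq_tsum hT hb, quadForm_eq_tsum CFC.rpow_nonneg
    fun i => rpow_apply_eigenvector_nnreal hT hq0 (hb i)]
  simp_rw [ENNReal.coe_rpow_of_nonneg _ hq0, mul_comm (_ : ℝ≥0∞) (ENNReal.ofReal _)]
  refine ENNReal.tsum_mul_rpow_le ?_ hq
  -- By Parseval the weights `|⟨b i, x⟩|²` sum to one.
  rw [← ofReal_norm_sq_eq_tsum, hx]
  simp

/-- Jensen's inequality for the vector state of a unit vector and a concave power. -/
theorem quadForm_rpow_ge {T : H →L[ℂ] H} (hT : 0 ≤ T) (hc : IsCompactOperator T) {q : ℝ}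
    (hq0 : 0 < q) (hq : q ≤ 1) {x : H} (hx : ‖x‖ = 1) :
    quadForm (T ^ q) x ≤ quadForm T x ^ q := by
  obtain ⟨ι, b, t, hb⟩ := exists_hilbertBasis_eigenvectors hT hc
  -- The concave case is the convex one for the exponent `q⁻¹`, applied to the values `t i ^ q`.
  rw [quadForm_eq_tsum hT hb, quadForm_eq_tsum CFC.rpow_nonneg
    fun i => rpow_apply_eigenvector_nnreal hT hq0.le (hb i), ← inv_inv q,
    ENNReal.le_rpow_inv_iff (inv_pos.mpr hq0), inv_inv]
  simp_rw [ENNReal.coe_rpow_of_nonneg _ hq0.le, mul_comm (_ : ℝ≥0∞) (ENNReal.ofReal _)]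
  refine (ENNReal.tsum_mul_rpow_le ?_ (one_le_inv_iff₀.mpr ⟨hq0, hq⟩)).trans_eq ?_
  · rw [← ofReal_norm_sq_eq_tsum, hx]
    simp
  · simp_rw [ENNReal.rpow_rpow_inv hq0.ne']

/-- If `T ≤ S` and `x` is a unit eigenvector of `T` with eigenvalue `t`, then
`t ^ r ≤ ⟨x, S ^ r x⟩` for every `r ≥ 0`. -/
theorem rpow_le_quadForm_rpow {S T : H →L[ℂ] H} (hT : 0 ≤ T) (hTS : T ≤ S)
    (hS : IsCompactOperator S) {r : ℝ} (hr : 0 ≤ r) {t : ℝ≥0} {x : H} (h1 : ‖x‖ = 1)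
    (hx : T x = ((t : ℝ) : ℂ) • x) : ((t ^ r : ℝ≥0) : ℝ≥0∞) ≤ quadForm (S ^ r) x := by
  -- Up to `r = 1` powers are operator monotone; beyond that this fails, but Jensen at the single
  -- vector `x` suffices.
  rcases le_total r 1 with h | h
  · rw [← quadForm_eigenvector (rpow_apply_eigenvector_nnreal hT hr hx) h1]
    exact quadForm_mono (CFC.rpow_le_rpow ⟨hr, h⟩ hTS) x
  · refine le_trans ?_ (quadForm_rpow_le (hT.trans hTS) hS h h1)
    rw [ENNReal.coe_rpow_of_nonneg _ hr, ← quadForm_eigenvector hx h1]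
    exact ENNReal.rpow_le_rpow (quadForm_mono hTS x) hr

/-- If `T ≤ S` and `x` is a unit eigenvector of `T` with eigenvalue `t`, then
`⟨x, S ^ (-r) x⟩ ≤ t ^ (-r)` for `0 ≤ r ≤ 1`, in the eigenbasis of `S`. -/
theorem tsum_rpow_neg_le {ι : Type*} {S T : H →L[ℂ] H} (hT : 0 ≤ T) (hTS : T ≤ S)
    {b : HilbertBasis ι ℂ H} {s : ι → ℝ≥0} (hb : ∀ i, S (b i) = ((s i : ℝ) : ℂ) • b i) {r : ℝ}
    (hr : 0 ≤ r) (hr1 : r ≤ 1) {t : ℝ≥0} (ht : t ≠ 0) {x : H} (h1 : ‖x‖ = 1)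
    (hx : T x = ((t : ℝ) : ℂ) • x) :
    ∑' i, ((s i ^ (-r) : ℝ≥0) : ℝ≥0∞) * ENNReal.ofReal (‖⟪b i, x⟫_ℂ‖ ^ 2)
      ≤ ((t ^ (-r) : ℝ≥0) : ℝ≥0∞) := by
  rw [ENNReal.tsum_eq_iSup_sum]
  refine iSup_le fun F => ?_
  have hTr : (0 : H →L[ℂ] H) ≤ T ^ r := CFC.rpow_nonneg
  have hsym := ((ContinuousLinearMap.nonneg_iff_isPositive _).mp hTr).inner_left_eq_inner_right
  set τ : ℝ := ((t ^ r : ℝ≥0) : ℝ) with hτ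
  have hτ0 : 0 < τ := by rw [hτ]; exact_mod_cast NNReal.rpow_pos (pos_iff_ne_zero.mpr ht)
  set c : ℝ := ∑ i ∈ F, ((s i ^ (-r) : ℝ≥0) : ℝ) * ‖⟪b i, x⟫_ℂ‖ ^ 2 with hc
  -- A finite truncation of `S^(-r) x`, so that `⟨g, x⟩ = ⟨g, S^r g⟩ = c`.
  set g : H := ∑ i ∈ F, ((((s i ^ (-r) : ℝ≥0) : ℝ) : ℂ) * ⟪b i, x⟫_ℂ) • b i with hg
  have hxT : (T ^ r) x = (τ : ℂ) • x := rpow_apply_eigenvector_nnreal hT hr hx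
  have hgx : ⟪g, x⟫_ℂ = c := by
    rw [hg, sum_inner, hc]
    push_cast
    refine Finset.sum_congr rfl fun i _ => ?_
    rw [inner_smul_left, map_mul, Complex.conj_ofReal, mul_assoc, Complex.conj_mul']
  have hxg : ⟪x, g⟫_ℂ = c := by rw [← inner_conj_symm, hgx, Complex.conj_ofReal]
  have hSg : ⟪g, (S ^ r) g⟫_ℂ = c := by
    have h2 : (S ^ r) g = ∑ i ∈ F, ((((s i ^ r * s i ^ (-r) : ℝ≥0) : ℝ) : ℂ) * ⟪b i, x⟫_ℂ) • b i := by
      rw [hg, map_sum]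
      refine Finset.sum_congr rfl fun i _ => ?_
      rw [map_smul, rpow_apply_eigenvector_nnreal (hT.trans hTS) hr (hb i), smul_smul]
      congr 1
      push_cast
      ring
    rw [h2, hg, b.orthonormal.inner_sum, hc]
    push_cast
    refine Finset.sum_congr rfl fun i _ => ?_
    -- On the kernel of `S`, `0 ^ (-r)` is `0` for `r > 0` and `1` for `r = 0`; the identity
    -- survives both.
    have h3 : s i ^ (-r) * (s i ^ r * s i ^ (-r)) = s i ^ (-r) := by
      rcases eq_or_ne (s i) 0 with h0 | h0
      · rcases hr.eq_or_lt with h | h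
        · simp [← h]
        · simp [h0, NNReal.zero_rpow (neg_ne_zero.mpr h.ne')]
      · rw [← NNReal.rpow_add h0]; simp
    rw [map_mul, Complex.conj_ofReal, mul_mul_mul_comm, Complex.conj_mul']
    congr 1
    exact_mod_cast h3
  have hTg : (⟪g, (T ^ r) g⟫_ℂ).re ≤ c := by
    have := re_inner_apply_nonneg (sub_nonneg.mpr (CFC.rpow_le_rpow ⟨hr, hr1⟩ hTS)) g
    rw [sub_apply, inner_sub_right, Complex.sub_re, hSg, Complex.ofReal_re] at this
    linarith
  -- Positivity of `T^r` at `x - τ g`; with `⟨g, T^r g⟩ ≤ c` it yields `τ² c ≤ τ`.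
  have hmain : 0 ≤ τ - 2 * τ ^ 2 * c + τ ^ 2 * (⟪g, (T ^ r) g⟫_ℂ).re := by
    have h2 : ⟪x - (τ : ℂ) • g, (T ^ r) (x - (τ : ℂ) • g)⟫_ℂ
        = ((τ - 2 * τ ^ 2 * c : ℝ) : ℂ) + ((τ ^ 2 : ℝ) : ℂ) * ⟪g, (T ^ r) g⟫_ℂ := by
      rw [map_sub, map_smul, hxT, inner_sub_left, inner_sub_right, inner_sub_right]
      simp only [inner_smul_left, inner_smul_right]
      rw [← hsym x g, hxT, inner_smul_left, hxg, hgx, inner_self_eq_norm_sq_to_K, h1,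
        Complex.conj_ofReal]
      push_cast
      ring
    have h3 := re_inner_apply_nonneg hTr (x - (τ : ℂ) • g)
    rwa [h2, Complex.add_re, Complex.ofReal_re, Complex.re_ofReal_mul] at h3
  have hfin : τ * c ≤ 1 := by
    refine le_of_mul_le_mul_left ?_ hτ0
    nlinarith [mul_le_mul_of_nonneg_left hTg (sq_nonneg τ)]
  have hle : c ≤ ((t ^ (-r) : ℝ≥0) : ℝ) := by
    rw [NNReal.rpow_neg, NNReal.coe_inv, ← one_div, le_div_iff₀ hτ0, mul_comm]
    exact hfin
  calc _ = ENNReal.ofReal c := by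
        rw [hc, ENNReal.ofReal_sum_of_nonneg fun i _ => by positivity]
        refine Finset.sum_congr rfl fun i _ => ?_
        rw [ENNReal.ofReal_mul (NNReal.coe_nonneg _), ENNReal.ofReal_coe_nnreal]
    _ ≤ _ := (ENNReal.ofReal_le_ofReal hle).trans_eq (ENNReal.ofReal_coe_nnreal)

end QuadForm

/-! ### Super- and subadditivity, convexity and monotonicity of trace powers. -/

section TraceInequalities

open scoped ENNReal NNReal

variable {H : Type*} [NormedAddCommGroup H] [InnerProductSpace ℂ H] [CompleteSpace H]

theorem NNReal.rpow_sub_one_mul_self (x : ℝ≥0) {q : ℝ} (hq : 0 < q) : x ^ (q - 1) * x = x ^ q := by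
  rcases eq_or_ne x 0 with rfl | h
  · rw [mul_zero, NNReal.zero_rpow hq.ne']
  · rw [← NNReal.rpow_add_one h, sub_add_cancel]

omit [CompleteSpace H] in
-- For `w i = s i ^ (q-1)` the left side is `tr(S^(q-1) T)`; Tonelli moves it to the eigenbasis of
-- `T`.
theorem tsum_mul_quadForm {ι κ : Type*} {T : H →L[ℂ] H} (hT : 0 ≤ T) (b : HilbertBasis ι ℂ H)
    {c : HilbertBasis κ ℂ H} {t : κ → ℝ≥0} (hc : ∀ j, T (c j) = ((t j : ℝ) : ℂ) • c j)
    (w : ι → ℝ≥0∞) :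
    ∑' i, w i * quadForm T (b i)
      = ∑' j, (t j : ℝ≥0∞) * ∑' i, w i * ENNReal.ofReal (‖⟪b i, c j⟫_ℂ‖ ^ 2) := by
  simp_rw [quadForm_eq_tsum hT hc, ← ENNReal.tsum_mul_left]
  rw [ENNReal.tsum_comm]
  refine tsum_congr fun j => tsum_congr fun i => ?_
  rw [norm_inner_symm, mul_left_comm]

theorem posTrace_rpow_le_tsum {ι : Type*} {S T : H →L[ℂ] H} (hT : 0 ≤ T) (hTS : T ≤ S)
    (hTc : IsCompactOperator T) (hSc : IsCompactOperator S) {b : HilbertBasis ι ℂ H} {s : ι → ℝ≥0}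
    (hb : ∀ i, S (b i) = ((s i : ℝ) : ℂ) • b i) {q : ℝ} (hq : 1 ≤ q) :
    posTrace (T ^ q) ≤ ∑' i, ((s i ^ (q - 1) : ℝ≥0) : ℝ≥0∞) * quadForm T (b i) := by
  obtain ⟨κ, c, t, hc⟩ := exists_hilbertBasis_eigenvectors hT hTc
  have hq0 : 0 < q := by linarith
  rw [posTrace_rpow_eq_tsum hT hc hq0.le, tsum_mul_quadForm hT b hc]
  refine ENNReal.tsum_le_tsum fun j => ?_
  rw [← NNReal.rpow_sub_one_mul_self _ hq0, mul_comm, ENNReal.coe_mul]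
  gcongr
  refine (rpow_le_quadForm_rpow hT hTS hSc (sub_nonneg.mpr hq) (c.orthonormal.1 j) (hc j)).trans_eq
    (quadForm_eq_tsum CFC.rpow_nonneg (fun i =>
      rpow_apply_eigenvector_nnreal (hT.trans hTS) (sub_nonneg.mpr hq) (hb i)) _)

theorem tsum_le_posTrace_rpow {ι : Type*} {S T : H →L[ℂ] H} (hT : 0 ≤ T) (hTS : T ≤ S)
    (hTc : IsCompactOperator T) {b : HilbertBasis ι ℂ H} {s : ι → ℝ≥0}
    (hb : ∀ i, S (b i) = ((s i : ℝ) : ℂ) • b i) {q : ℝ} (hq0 : 0 < q) (hq : q ≤ 1) :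
    ∑' i, ((s i ^ (q - 1) : ℝ≥0) : ℝ≥0∞) * quadForm T (b i) ≤ posTrace (T ^ q) := by
  obtain ⟨κ, c, t, hc⟩ := exists_hilbertBasis_eigenvectors hT hTc
  rw [posTrace_rpow_eq_tsum hT hc hq0.le, tsum_mul_quadForm hT b hc]
  refine ENNReal.tsum_le_tsum fun j => ?_
  -- The negative-power bound needs `t j ≠ 0`; otherwise the factor `t j` kills the term.
  rcases eq_or_ne (t j) 0 with h | h
  · simp [h]
  rw [← NNReal.rpow_sub_one_mul_self (t j) hq0, mul_comm (t j ^ _), ENNReal.coe_mul]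
  gcongr
  simpa only [neg_sub] using tsum_rpow_neg_le hT hTS hb (r := 1 - q) (by linarith) (by linarith) h
    (c.orthonormal.1 j) (hc j)

theorem posTrace_rpow_eq_tsum_mul_quadForm {ι : Type*} {S : H →L[ℂ] H} (hS : 0 ≤ S)
    {b : HilbertBasis ι ℂ H} {s : ι → ℝ≥0} (hb : ∀ i, S (b i) = ((s i : ℝ) : ℂ) • b i) {q : ℝ}
    (hq : 0 < q) :
    posTrace (S ^ q) = ∑' i, ((s i ^ (q - 1) : ℝ≥0) : ℝ≥0∞) * quadForm S (b i) := by
  rw [posTrace_rpow_eq_tsum hS hb hq.le]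
  refine tsum_congr fun i => ?_
  rw [quadForm_eigenvector (hb i) (b.orthonormal.1 i), ← ENNReal.coe_mul,
    NNReal.rpow_sub_one_mul_self _ hq]

omit [CompleteSpace H] in
theorem isCompactOperator_finset_sum {κ : Type*} (F : Finset κ) {T : κ → H →L[ℂ] H}
    (hc : ∀ k ∈ F, IsCompactOperator (T k)) :
    IsCompactOperator (∑ k ∈ F, T k : H →L[ℂ] H) := by
  classical
  induction F using Finset.induction_on with
  | empty => simpa using isCompactOperator_zero
  | insert a F ha ih =>
    rw [Finset.sum_insert ha]
    exact (hc a (Finset.mem_insert_self _ _)).add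
      (ih fun k hk => hc k (Finset.mem_insert_of_mem hk))

section Sum

variable {κ : Type*} (F : Finset κ) {T : κ → H →L[ℂ] H} (hT : ∀ k ∈ F, 0 ≤ T k)
  (hc : ∀ k ∈ F, IsCompactOperator (T k)) {q : ℝ}

include hT hc

/-- McCarthy's inequality: the trace of a power `q ≥ 1` is superadditive. -/
theorem sum_posTrace_rpow_le (hq : 1 ≤ q) :
    ∑ k ∈ F, posTrace (T k ^ q) ≤ posTrace ((∑ k ∈ F, T k) ^ q) := by
  have hS := Finset.sum_nonneg hT
  have hSc := isCompactOperator_finset_sum F hc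
  obtain ⟨ι, b, s, hb⟩ := exists_hilbertBasis_eigenvectors hS hSc
  rw [posTrace_rpow_eq_tsum_mul_quadForm hS hb (by linarith)]
  simp_rw [quadForm_sum F hT, Finset.mul_sum]
  rw [Summable.tsum_finsetSum fun _ _ => ENNReal.summable]
  exact Finset.sum_le_sum fun k hk =>
    posTrace_rpow_le_tsum (hT k hk) (Finset.single_le_sum hT hk) (hc k hk) hSc hb hq

/-- The trace of a power `0 < q ≤ 1` is subadditive. -/
theorem posTrace_rpow_sum_le (hq0 : 0 < q) (hq : q ≤ 1) :
    posTrace ((∑ k ∈ F, T k) ^ q) ≤ ∑ k ∈ F, posTrace (T k ^ q) := by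
  have hS := Finset.sum_nonneg hT
  obtain ⟨ι, b, s, hb⟩ := exists_hilbertBasis_eigenvectors hS (isCompactOperator_finset_sum F hc)
  rw [posTrace_rpow_eq_tsum_mul_quadForm hS hb hq0]
  simp_rw [quadForm_sum F hT, Finset.mul_sum]
  rw [Summable.tsum_finsetSum fun _ _ => ENNReal.summable]
  exact Finset.sum_le_sum fun k hk =>
    tsum_le_posTrace_rpow (hT k hk) (Finset.single_le_sum hT hk) (hc k hk) hb hq0 hq

/-- Convexity of the trace of a power `q ≥ 1`. -/
theorem posTrace_rpow_sum_le_card_mul (hq : 1 ≤ q) :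
    posTrace ((∑ k ∈ F, T k) ^ q)
      ≤ (F.card : ℝ≥0∞) ^ (q - 1) * ∑ k ∈ F, posTrace (T k ^ q) := by
  have hS := Finset.sum_nonneg hT
  obtain ⟨ι, b, s, hb⟩ := exists_hilbertBasis_eigenvectors hS (isCompactOperator_finset_sum F hc)
  have hq0 : 0 ≤ q := by linarith
  rw [posTrace_rpow_eq_tsum hS hb hq0]
  -- In the eigenbasis of the sum, each eigenvalue is `∑ k, ⟨b i, T k (b i)⟩`: the scalar power-mean
  -- inequality applies, then Jensen for each `T k`.
  calc _ ≤ ∑' i, (F.card : ℝ≥0∞) ^ (q - 1) * ∑ k ∈ F, quadForm (T k ^ q) (b i) := by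
        refine ENNReal.tsum_le_tsum fun i => ?_
        rw [ENNReal.coe_rpow_of_nonneg _ hq0,
          ← quadForm_eigenvector (hb i) (b.orthonormal.1 i), quadForm_sum F hT]
        refine (ENNReal.rpow_sum_le_const_mul_sum_rpow F _ hq).trans ?_
        gcongr with k hk
        exact quadForm_rpow_le (hT k hk) (hc k hk) hq (b.orthonormal.1 i)
    _ = _ := by
        rw [ENNReal.tsum_mul_left, Summable.tsum_finsetSum fun _ _ => ENNReal.summable]
        simp_rw [posTrace_eq_tsum_quadForm (CFC.rpow_nonneg (a := T _)) b]

omit hT hc in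
theorem ENNReal.sum_rpow_le_const_mul_rpow_sum (f : κ → ℝ≥0∞) (hq0 : 0 < q) (hq : q ≤ 1) :
    ∑ k ∈ F, f k ^ q ≤ (F.card : ℝ≥0∞) ^ (1 - q) * (∑ k ∈ F, f k) ^ q := by
  have h := ENNReal.rpow_sum_le_const_mul_sum_rpow F (fun k => f k ^ q)
    (one_le_inv_iff₀.mpr ⟨hq0, hq⟩)
  rw [ENNReal.rpow_inv_le_iff hq0, ENNReal.mul_rpow_of_nonneg _ _ hq0.le, ← ENNReal.rpow_mul] at h
  simp_rw [ENNReal.rpow_rpow_inv hq0.ne'] at h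
  rwa [sub_mul, inv_mul_cancel₀ hq0.ne', one_mul] at h

/-- Concavity of the trace of a power `0 < q ≤ 1`. -/
theorem sum_posTrace_rpow_le_card_mul (hq0 : 0 < q) (hq : q ≤ 1) :
    ∑ k ∈ F, posTrace (T k ^ q)
      ≤ (F.card : ℝ≥0∞) ^ (1 - q) * posTrace ((∑ k ∈ F, T k) ^ q) := by
  have hS := Finset.sum_nonneg hT
  obtain ⟨ι, b, s, hb⟩ := exists_hilbertBasis_eigenvectors hS (isCompactOperator_finset_sum F hc)
  rw [posTrace_rpow_eq_tsum hS hb hq0.le]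
  simp_rw [posTrace_eq_tsum_quadForm (CFC.rpow_nonneg (a := T _)) b]
  rw [← Summable.tsum_finsetSum fun _ _ => ENNReal.summable, ← ENNReal.tsum_mul_left]
  refine ENNReal.tsum_le_tsum fun i => ?_
  rw [ENNReal.coe_rpow_of_nonneg _ hq0.le,
    ← quadForm_eigenvector (hb i) (b.orthonormal.1 i), quadForm_sum F hT]
  refine le_trans ?_ (ENNReal.sum_rpow_le_const_mul_rpow_sum F _ hq0 hq)
  exact Finset.sum_le_sum fun k hk => quadForm_rpow_ge (hT k hk) (hc k hk) hq0 hq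
    (b.orthonormal.1 i)

end Sum

/-- For `q > 1` the operator inequality `T^q ≤ S^q` may fail, yet the diagonal entries in the
eigenbasis of `T` still compare. -/
theorem posTrace_rpow_mono {S T : H →L[ℂ] H} (hT : 0 ≤ T) (hTS : T ≤ S)
    (hTc : IsCompactOperator T) (hSc : IsCompactOperator S) {q : ℝ} (hq : 0 ≤ q) :
    posTrace (T ^ q) ≤ posTrace (S ^ q) := by
  obtain ⟨κ, c, t, hc⟩ := exists_hilbertBasis_eigenvectors hT hTc
  rw [posTrace_rpow_eq_tsum hT hc hq, posTrace_eq_tsum_quadForm CFC.rpow_nonneg c]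
  exact ENNReal.tsum_le_tsum fun j =>
    rpow_le_quadForm_rpow hT hTS hSc hq (c.orthonormal.1 j) (hc j)

theorem posTrace_smul_rpow {T : H →L[ℂ] H} (hT : 0 ≤ T) (hTc : IsCompactOperator T) (a : ℝ≥0)
    {q : ℝ} (hq : 0 ≤ q) :
    posTrace ((((a : ℝ) : ℂ) • T) ^ q) = (a : ℝ≥0∞) ^ q * posTrace (T ^ q) := by
  obtain ⟨κ, c, t, hc⟩ := exists_hilbertBasis_eigenvectors hT hTc
  have ha : (0 : H →L[ℂ] H) ≤ ((a : ℝ) : ℂ) • T := by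
    rw [Complex.coe_smul]
    exact smul_nonneg a.2 hT
  have hc' : ∀ j, (((a : ℝ) : ℂ) • T) (c j) = (((a * t j : ℝ≥0) : ℝ) : ℂ) • c j := fun j => by
    rw [smul_apply, hc, smul_smul]
    push_cast
    rfl
  rw [posTrace_rpow_eq_tsum ha hc' hq, posTrace_rpow_eq_tsum hT hc hq, ← ENNReal.tsum_mul_left]
  refine tsum_congr fun j => ?_
  rw [NNReal.mul_rpow, ENNReal.coe_mul, ENNReal.coe_rpow_of_nonneg _ hq]

end TraceInequalities

/-! ### Schatten classes are closed under sums. -/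

section SchattenClass

open scoped ENNReal NNReal

variable {H : Type*} [NormedAddCommGroup H] [InnerProductSpace ℂ H] [CompleteSpace H]

/-- Reduces everything to the positive operators `A*A` with exponent `p/2`, which makes `p = 2` the
threshold. -/
theorem traceAbsPow_eq_posTrace {p : ℝ} (hp : 0 ≤ p) (A : H →L[ℂ] H) :
    traceAbsPow p A = posTrace ((star A * A) ^ (p / 2)) := by
  have hA : 0 ≤ star A * A := star_mul_self_nonneg A
  rw [traceAbsPow, CFC.abs, CFC.sqrt_eq_rpow,
    CFC.rpow_rpow_of_exponent_nonneg _ _ _ (by norm_num) hp, one_div_mul_eq_div]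

theorem traceAbsPow_neg (p : ℝ) (A : H →L[ℂ] H) : traceAbsPow p (-A) = traceAbsPow p A := by
  rw [traceAbsPow, CFC.abs_neg, traceAbsPow]

theorem isCompactOperator_star_mul_self {A : H →L[ℂ] H} (hA : IsCompactOperator A) :
    IsCompactOperator (star A * A : H →L[ℂ] H) :=
  hA.clm_comp (star A)

theorem posTrace_rpow_sum_lt_top {κ : Type*} (F : Finset κ) {T : κ → H →L[ℂ] H}
    (hT : ∀ k ∈ F, 0 ≤ T k) (hc : ∀ k ∈ F, IsCompactOperator (T k)) {q : ℝ} (hq : 0 < q)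
    (h : ∀ k ∈ F, posTrace (T k ^ q) < ⊤) : posTrace ((∑ k ∈ F, T k) ^ q) < ⊤ := by
  have hfin : ∑ k ∈ F, posTrace (T k ^ q) < ⊤ := ENNReal.sum_lt_top.mpr h
  rcases le_total q 1 with h1 | h1
  · exact (posTrace_rpow_sum_le F hT hc hq h1).trans_lt hfin
  · refine (posTrace_rpow_sum_le_card_mul F hT hc h1).trans_lt (ENNReal.mul_lt_top ?_ hfin)
    exact ENNReal.rpow_lt_top_of_nonneg (by linarith) (ENNReal.natCast_ne_top _)

theorem SchattenClass.neg_mem {p : ℝ} {A : H →L[ℂ] H} (hA : A ∈ SchattenClass p) :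
    -A ∈ SchattenClass p :=
  ⟨hA.1.neg, (traceAbsPow_neg p A).trans_lt hA.2⟩

/-- Parallelogram identity, with the positive term `|T 0 - T 1|²` dropped. -/
theorem star_add_mul_self_le (T : Fin 2 → H →L[ℂ] H) :
    star (∑ k, T k) * ∑ k, T k ≤ ∑ k, (((2 : ℝ≥0) : ℝ) : ℂ) • (star (T k) * T k) := by
  have h : ∑ k, (((2 : ℝ≥0) : ℝ) : ℂ) • (star (T k) * T k)
      = star (∑ k, T k) * ∑ k, T k + star (T 0 - T 1) * (T 0 - T 1) := by
    simp only [Fin.sum_univ_two, NNReal.coe_ofNat, Complex.ofReal_ofNat,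
      two_smul, star_add, star_sub, add_mul, mul_add, sub_mul, mul_sub]
    abel
  rw [h]
  exact le_add_of_nonneg_right (star_mul_self_nonneg _)

theorem smul_star_mul_self_nonneg (a : ℝ≥0) (A : H →L[ℂ] H) :
    0 ≤ ((a : ℝ) : ℂ) • (star A * A) := by
  rw [Complex.coe_smul]
  exact smul_nonneg (NNReal.coe_nonneg a) (star_mul_self_nonneg A)

theorem posTrace_smul_star_mul_self_lt_top {p : ℝ} (hp : 0 < p) (a : ℝ≥0) {A : H →L[ℂ] H}
    (hA : A ∈ SchattenClass p) : posTrace ((((a : ℝ) : ℂ) • (star A * A)) ^ (p / 2)) < ⊤ := by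
  have hq : 0 ≤ p / 2 := by linarith
  rw [posTrace_smul_rpow (star_mul_self_nonneg A) (isCompactOperator_star_mul_self hA.1) a hq,
    ← traceAbsPow_eq_posTrace hp.le]
  exact ENNReal.mul_lt_top (ENNReal.rpow_lt_top_of_nonneg hq ENNReal.coe_ne_top) hA.2

theorem SchattenClass.sum_two_mem {p : ℝ} (hp : 0 < p) {T : Fin 2 → H →L[ℂ] H}
    (hT : ∀ k, T k ∈ SchattenClass p) : ∑ k, T k ∈ SchattenClass p := by
  have hq : 0 < p / 2 := by linarith
  have hc : IsCompactOperator (∑ k, T k : H →L[ℂ] H) :=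
    isCompactOperator_finset_sum _ fun k _ => (hT k).1
  have hTc : ∀ k ∈ Finset.univ,
      IsCompactOperator ((((2 : ℝ≥0) : ℝ) : ℂ) • (star (T k) * T k) : H →L[ℂ] H) :=
    fun k _ => (isCompactOperator_star_mul_self (hT k).1).smul (((2 : ℝ≥0) : ℝ) : ℂ)
  refine ⟨hc, ?_⟩
  rw [traceAbsPow_eq_posTrace hp.le]
  have h1 := posTrace_rpow_mono (star_mul_self_nonneg (∑ k, T k)) (star_add_mul_self_le T)
    (isCompactOperator_star_mul_self hc) (isCompactOperator_finset_sum _ hTc) hq.le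
  have h2 := posTrace_rpow_sum_lt_top Finset.univ
    (fun k _ => smul_star_mul_self_nonneg 2 (T k)) hTc hq
    fun k _ => posTrace_smul_star_mul_self_lt_top hp 2 (hT k)
  exact h1.trans_lt h2

theorem SchattenClass.add_mem {p : ℝ} (hp : 0 < p) {A B : H →L[ℂ] H} (hA : A ∈ SchattenClass p)
    (hB : B ∈ SchattenClass p) : A + B ∈ SchattenClass p := by
  simpa using SchattenClass.sum_two_mem hp (T := ![A, B]) (Fin.forall_fin_two.mpr ⟨hA, hB⟩)

theorem schattenNorm_rpow {p : ℝ} (hp : 0 < p) (A : H →L[ℂ] H) :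
    schattenNorm p A ^ p = (traceAbsPow p A).toReal := by
  rw [schattenNorm, ← Real.rpow_mul ENNReal.toReal_nonneg, one_div_mul_cancel hp.ne', Real.rpow_one]

/-! ### The inequalities for a family with zero sum. -/

section Sum

variable {n : ℕ} {p : ℝ} {A B : Fin n → H →L[ℂ] H}

/-- The cross terms factor through `∑ A i = 0`. The second family `B` treats both signs at once: `B
= A` and `B = -A`. -/
theorem sum_star_mul_self_add (hsum : ∑ i, A i = 0) (hAB : ∀ i, star (B i) * B i = star (A i) * A i) :
    ∑ k : Fin n × Fin n, star (A k.1 + B k.2) * (A k.1 + B k.2)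
      = (((2 * n : ℝ≥0) : ℝ) : ℂ) • ∑ i, star (A i) * A i := by
  have h1 : ∑ i, ∑ j, star (A i) * B j = 0 := by
    simp_rw [← Finset.mul_sum, ← Finset.sum_mul, ← star_sum, hsum, star_zero, zero_mul]
  have h2 : ∑ i, ∑ j, star (B j) * A i = 0 := by
    rw [Finset.sum_comm]
    simp_rw [← Finset.mul_sum, hsum, mul_zero, Finset.sum_const_zero]
  rw [Fintype.sum_prod_type]
  simp only [star_add, add_mul, mul_add, Finset.sum_add_distrib, h1, h2, hAB, Finset.sum_const,
    Finset.card_univ, Fintype.card_fin, ← Finset.smul_sum]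
  push_cast
  rw [mul_smul, two_smul, Nat.cast_smul_eq_nsmul]
  abel

theorem posTrace_sum_star_mul_self_add (hp : 0 < p) (hA : ∀ i, IsCompactOperator (A i))
    (hsum : ∑ i, A i = 0) (hAB : ∀ i, star (B i) * B i = star (A i) * A i) :
    posTrace ((∑ k : Fin n × Fin n, star (A k.1 + B k.2) * (A k.1 + B k.2)) ^ (p / 2))
      = ((2 * n : ℝ≥0) : ℝ≥0∞) ^ (p / 2) * posTrace ((∑ i, star (A i) * A i) ^ (p / 2)) := by
  rw [sum_star_mul_self_add hsum hAB, posTrace_smul_rpow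
    (Finset.sum_nonneg fun i _ => star_mul_self_nonneg (A i)) (isCompactOperator_finset_sum _
      fun i _ => isCompactOperator_star_mul_self (hA i)) _ (by linarith)]

theorem sum_traceAbsPow_add_le (hp : 2 ≤ p) (hA : ∀ i, IsCompactOperator (A i))
    (hB : ∀ i, IsCompactOperator (B i)) (hsum : ∑ i, A i = 0)
    (hAB : ∀ i, star (B i) * B i = star (A i) * A i) :
    ∑ i, ∑ j, traceAbsPow p (A i + B j)
      ≤ ((2 * n : ℝ≥0) : ℝ≥0∞) ^ (p / 2) * ((n : ℝ≥0∞) ^ (p / 2 - 1) * ∑ i, traceAbsPow p (A i)) := by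
  have hp0 : 0 < p := by linarith
  have h1 := sum_posTrace_rpow_le Finset.univ
    (fun (k : Fin n × Fin n) _ => star_mul_self_nonneg (A k.1 + B k.2))
    (fun k _ => isCompactOperator_star_mul_self ((hA k.1).add (hB k.2))) (q := p / 2) (by linarith)
  have h2 := posTrace_rpow_sum_le_card_mul Finset.univ (fun i _ => star_mul_self_nonneg (A i))
    (fun i _ => isCompactOperator_star_mul_self (hA i)) (q := p / 2) (by linarith)
  rw [posTrace_sum_star_mul_self_add hp0 hA hsum hAB, Fintype.sum_prod_type] at h1
  rw [Finset.card_univ, Fintype.card_fin] at h2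
  simp_rw [traceAbsPow_eq_posTrace hp0.le]
  exact h1.trans (by gcongr)

theorem sum_traceAbsPow_add_ge (hp0 : 0 < p) (hp : p ≤ 2) (hA : ∀ i, IsCompactOperator (A i))
    (hB : ∀ i, IsCompactOperator (B i)) (hsum : ∑ i, A i = 0)
    (hAB : ∀ i, star (B i) * B i = star (A i) * A i) :
    ((2 * n : ℝ≥0) : ℝ≥0∞) ^ (p / 2) * ∑ i, traceAbsPow p (A i)
      ≤ (n : ℝ≥0∞) ^ (1 - p / 2) * ∑ i, ∑ j, traceAbsPow p (A i + B j) := by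
  have h1 := posTrace_rpow_sum_le Finset.univ
    (fun (k : Fin n × Fin n) _ => star_mul_self_nonneg (A k.1 + B k.2))
    (fun k _ => isCompactOperator_star_mul_self ((hA k.1).add (hB k.2))) (q := p / 2)
    (by linarith) (by linarith)
  have h2 := sum_posTrace_rpow_le_card_mul Finset.univ (fun i _ => star_mul_self_nonneg (A i))
    (fun i _ => isCompactOperator_star_mul_self (hA i)) (q := p / 2) (by linarith) (by linarith)
  rw [posTrace_sum_star_mul_self_add hp0 hA hsum hAB, Fintype.sum_prod_type] at h1
  rw [Finset.card_univ, Fintype.card_fin] at h2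
  simp_rw [traceAbsPow_eq_posTrace hp0.le]
  calc _ ≤ _ := mul_le_mul_right h2 _
    _ = _ := mul_left_comm _ _ _
    _ ≤ _ := mul_le_mul_right h1 _

theorem toReal_sum_traceAbsPow (hp : 0 < p) {κ : Type*} (F : Finset κ) {A : κ → H →L[ℂ] H}
    (hA : ∀ i, A i ∈ SchattenClass p) :
    (∑ i ∈ F, traceAbsPow p (A i)).toReal = ∑ i ∈ F, schattenNorm p (A i) ^ p := by
  rw [ENNReal.toReal_sum fun i _ => (hA i).2.ne]
  simp_rw [schattenNorm_rpow hp]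

theorem toReal_sum_sum_traceAbsPow (hp : 0 < p) {κ κ' : Type*} (F : Finset κ) (F' : Finset κ')
    {A : κ → κ' → H →L[ℂ] H} (hA : ∀ i j, A i j ∈ SchattenClass p) :
    (∑ i ∈ F, ∑ j ∈ F', traceAbsPow p (A i j)).toReal
      = ∑ i ∈ F, ∑ j ∈ F', schattenNorm p (A i j) ^ p := by
  rw [ENNReal.toReal_sum fun i _ => (ENNReal.sum_lt_top.mpr fun j _ => (hA i j).2).ne]
  simp_rw [toReal_sum_traceAbsPow hp F' (hA _)]

theorem sum_schattenNorm_add_le (hp : 2 ≤ p) (hA : ∀ i, A i ∈ SchattenClass p)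
    (hB : ∀ i, B i ∈ SchattenClass p) (hsum : ∑ i, A i = 0)
    (hAB : ∀ i, star (B i) * B i = star (A i) * A i) :
    ∑ i, ∑ j, schattenNorm p (A i + B j) ^ p
      ≤ (2 : ℝ) ^ (p / 2) * (n : ℝ) ^ (p - 1) * ∑ i, schattenNorm p (A i) ^ p := by
  have hp0 : 0 < p := by linarith
  rcases Nat.eq_zero_or_pos n with rfl | hn
  · simp
  have hn' : (0 : ℝ) < n := Nat.cast_pos.mpr hn
  have h := sum_traceAbsPow_add_le hp (fun i => (hA i).1) (fun i => (hB i).1) hsum hAB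
  have hfin : ∑ i, traceAbsPow p (A i) ≠ ⊤ := (ENNReal.sum_lt_top.mpr fun i _ => (hA i).2).ne
  -- `toReal` sends `⊤` to `0`, so finiteness of the larger side is needed first.
  have h := ENNReal.toReal_mono (ENNReal.mul_ne_top
    (ENNReal.rpow_ne_top_of_nonneg (by linarith) ENNReal.coe_ne_top) (ENNReal.mul_ne_top
      (ENNReal.rpow_ne_top_of_nonneg (by linarith) (ENNReal.natCast_ne_top n)) hfin)) h
  rw [toReal_sum_sum_traceAbsPow hp0 _ _ fun i j => SchattenClass.add_mem hp0 (hA i) (hB j),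
    ENNReal.toReal_mul, ENNReal.toReal_mul, toReal_sum_traceAbsPow hp0 _ hA,
    ← ENNReal.toReal_rpow, ← ENNReal.toReal_rpow, ENNReal.coe_toReal, ENNReal.toReal_natCast] at h
  push_cast at h
  rw [Real.mul_rpow two_pos.le hn'.le] at h
  refine h.trans_eq ?_
  rw [show p - 1 = p / 2 + (p / 2 - 1) by ring, Real.rpow_add hn']
  ring

theorem sum_schattenNorm_add_ge (hp0 : 0 < p) (hp : p ≤ 2) (hA : ∀ i, A i ∈ SchattenClass p)
    (hB : ∀ i, B i ∈ SchattenClass p) (hsum : ∑ i, A i = 0)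
    (hAB : ∀ i, star (B i) * B i = star (A i) * A i) :
    (2 : ℝ) ^ (p / 2) * (n : ℝ) ^ (p - 1) * ∑ i, schattenNorm p (A i) ^ p
      ≤ ∑ i, ∑ j, schattenNorm p (A i + B j) ^ p := by
  rcases Nat.eq_zero_or_pos n with rfl | hn
  · simp
  have hn' : (0 : ℝ) < n := Nat.cast_pos.mpr hn
  have hmem := fun i j => SchattenClass.add_mem hp0 (hA i) (hB j)
  have h := sum_traceAbsPow_add_ge hp0 hp (fun i => (hA i).1) (fun i => (hB i).1) hsum hAB
  have hfin : ∑ i, ∑ j, traceAbsPow p (A i + B j) ≠ ⊤ := (ENNReal.sum_lt_top.mpr fun i _ =>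
    ENNReal.sum_lt_top.mpr fun j _ => (hmem i j).2).ne
  have h := ENNReal.toReal_mono (ENNReal.mul_ne_top
    (ENNReal.rpow_ne_top_of_nonneg (by linarith) (ENNReal.natCast_ne_top n)) hfin) h
  rw [ENNReal.toReal_mul, ENNReal.toReal_mul, toReal_sum_sum_traceAbsPow hp0 _ _ hmem,
    toReal_sum_traceAbsPow hp0 _ hA,
    ← ENNReal.toReal_rpow, ← ENNReal.toReal_rpow, ENNReal.coe_toReal, ENNReal.toReal_natCast] at h
  push_cast at h
  rw [Real.mul_rpow two_pos.le hn'.le] at h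
  -- The concavity factor `n^(1-p/2)` is cancelled, leaving `n^(p/2) / n^(1-p/2) = n^(p-1)`.
  refine le_of_mul_le_mul_left ?_ (Real.rpow_pos_of_pos hn' (1 - p / 2))
  refine Eq.trans_le ?_ h
  have h2 : (n : ℝ) ^ (p / 2) = (n : ℝ) ^ (1 - p / 2) * (n : ℝ) ^ (p - 1) := by
    rw [← Real.rpow_add hn']
    ring_nf
  rw [h2]
  ring

end Sum

end SchattenClass

theorem mainTheorem3 {H : Type*} [NormedAddCommGroup H] [InnerProductSpace ℂ H]
    [CompleteSpace H] [TopologicalSpace.SeparableSpace H]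
    (n : ℕ) (p : ℝ) (hp : 0 < p) (A : Fin n → H →L[ℂ] H)
    (hA : ∀ i, A i ∈ SchattenClass p) (hsum : ∑ i, A i = 0) :
    (∀ i j, A i + A j ∈ SchattenClass p ∧ A i - A j ∈ SchattenClass p) ∧
    (p ≤ 2 →
      (2 : ℝ) ^ (p / 2) * (n : ℝ) ^ (p - 1) * ∑ i, schattenNorm p (A i) ^ p
          ≤ ∑ i, ∑ j, schattenNorm p (A i + A j) ^ p ∧
      (2 : ℝ) ^ (p / 2) * (n : ℝ) ^ (p - 1) * ∑ i, schattenNorm p (A i) ^ p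
          ≤ ∑ i, ∑ j, schattenNorm p (A i - A j) ^ p) ∧
    (2 ≤ p →
      ∑ i, ∑ j, schattenNorm p (A i + A j) ^ p
          ≤ (2 : ℝ) ^ (p / 2) * (n : ℝ) ^ (p - 1) * ∑ i, schattenNorm p (A i) ^ p ∧
      ∑ i, ∑ j, schattenNorm p (A i - A j) ^ p
          ≤ (2 : ℝ) ^ (p / 2) * (n : ℝ) ^ (p - 1) * ∑ i, schattenNorm p (A i) ^ p) ∧
    (p = 2 →
      ∑ i, ∑ j, schattenNorm 2 (A i - A j) ^ 2
        = 2 * (n : ℝ) * ∑ i, schattenNorm 2 (A i) ^ 2) := by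
  have hneg : ∀ i, -A i ∈ SchattenClass p := fun i => SchattenClass.neg_mem (hA i)
  have hstar : ∀ i, star (-A i) * -A i = star (A i) * A i := fun i => by simp
  have hle := fun h : p ≤ 2 => sum_schattenNorm_add_ge hp h hA hneg hsum hstar
  have hge := fun h : 2 ≤ p => sum_schattenNorm_add_le h hA hneg hsum hstar
  simp only [← sub_eq_add_neg] at hle hge
  refine ⟨fun i j => ⟨SchattenClass.add_mem hp (hA i) (hA j), ?_⟩,
    fun h => ⟨sum_schattenNorm_add_ge hp h hA hA hsum fun _ => rfl, hle h⟩,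
    fun h => ⟨sum_schattenNorm_add_le h hA hA hsum fun _ => rfl, hge h⟩, ?_⟩
  · rw [sub_eq_add_neg]
    exact SchattenClass.add_mem hp (hA i) (hneg j)
  · rintro rfl
    -- At `p = 2` both inequalities hold with the same constant `2n`.
    have h := le_antisymm (hge le_rfl) (hle le_rfl)
    norm_num at h
    exact h
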